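/- A geometric graph is a finite simple graph whose vertices are distinct points of the Euclidean plane and whose edges are straight-line segments, any two distinct edges having at most one common point in their relative interiors. Let $m$ be its number of edges and $I$ its number of crossings, that is, of unordered pairs of edges whose relative interiors meet. A symmetric partial edge drawing (SPED) of it is a choice of ratios $0<\delta_e\le\tfrac12$, one for each edge $e$, such that the stubs do not intersect. Here every edge $e$ of length $|e|$ is replaced by its two stubs, the relatively open subsegments of length $\delta_e|e|$ of $e$ that are incident to its two endpoints. The erased ink is $\sum_e(1-2\delta_e)|e|$ and the erased relative length is $\sum_e(1-2\delta_e)$. MinSPED asks for a SPED of the given geometric graph that minimizes the erased ink (or, in the second version, the erased relative length). Theorem. MinSPED, in either version, can be 2-approximated in time quadratic in the number of crossings. Precisely, on a real RAM (unit-cost exact real arithmetic $+,-,\cdot,/$, square roots and comparisons; unit-cost natural-number addition, subtraction, comparison and indirect addressing; no rounding), for each version: 1. There is an algorithm that, given the geometric graph stored in memory together with a list, in arbitrary order, of its pairs of crossing edges, outputs in $O(I^2+1)$ steps a SPED that erases at most twice as much as any SPED of that geometric graph. The output is stored as the erased fraction $1-2\delta_e$ of each edge, in memory cells that initially hold $0$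 (edge drawn entirely). 2. There is an algorithm that does the same given only the geometric graph, in $O(m^2+I^2+1)$ steps, where the $m^2$ accounts for finding the crossings (so the time is $O(I^2)$ if $m\ge 1$ and every edge is involved in a crossing). -/

import Mathlib

/-! ### A real random-access machine with a step count

Memory consists of finitely many (per program) arrays of natural numbers, used for counters and
addresses, and arrays of real numbers. Programs are finite, contain only natural and rational
constants, and can neither round real numbers nor convert them to natural numbers. Every memory
access, arithmetic operation, comparison and assignment costs one step. -/

namespace RealRAM

/-- `nat a i` and `real a i` are the contents of cell `i` of the `a`-th array of each kind. -/
structure State where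
  nat : ℕ → ℕ → ℕ
  real : ℕ → ℕ → ℝ

/-- Expressions for natural numbers (no multiplication; subtraction is truncated at `0`). -/
inductive NatExpr where
  | const (c : ℕ)
  | read (array : ℕ) (index : NatExpr)
  | plus (x y : NatExpr)
  | minus (x y : NatExpr)

namespace NatExpr

def eval (σ : State) : NatExpr → ℕ
  | const c => c
  | read a i => σ.nat a (i.eval σ)
  | plus x y => x.eval σ + y.eval σ
  | minus x y => x.eval σ - y.eval σ

def cost : NatExpr → ℕ
  | const _ => 1
  | read _ i => i.cost + 1
  | plus x y => x.cost + y.cost + 1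
  | minus x y => x.cost + y.cost + 1

end NatExpr

/-- Expressions for real numbers: exact arithmetic and square roots. -/
inductive RealExpr where
  | const (q : ℚ)
  | read (array : ℕ) (index : NatExpr)
  | plus (x y : RealExpr)
  | minus (x y : RealExpr)
  | times (x y : RealExpr)
  | quot (x y : RealExpr)
  | root (x : RealExpr)

namespace RealExpr

noncomputable def eval (σ : State) : RealExpr → ℝ
  | const q => (q : ℝ)
  | read a i => σ.real a (i.eval σ)
  | plus x y => x.eval σ + y.eval σ
  | minus x y => x.eval σ - y.eval σ
  | times x y => x.eval σ * y.eval σ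
  | quot x y => x.eval σ / y.eval σ
  | root x => Real.sqrt (x.eval σ)

def cost : RealExpr → ℕ
  | const _ => 1
  | read _ i => i.cost + 1
  | plus x y => x.cost + y.cost + 1
  | minus x y => x.cost + y.cost + 1
  | times x y => x.cost + y.cost + 1
  | quot x y => x.cost + y.cost + 1
  | root x => x.cost + 1

end RealExpr

/-- Tests. -/
inductive Test where
  | natLT (x y : NatExpr)
  | realLT (x y : RealExpr)
  | neg (b : Test)
  | both (b c : Test)

namespace Test

def Holds (σ : State) : Test → Prop
  | natLT x y => x.eval σ < y.eval σ
  | realLT x y => x.eval σ < y.eval σ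
  | neg b => ¬ b.Holds σ
  | both b c => b.Holds σ ∧ c.Holds σ

def cost : Test → ℕ
  | natLT x y => x.cost + y.cost + 1
  | realLT x y => x.cost + y.cost + 1
  | neg b => b.cost + 1
  | both b c => b.cost + c.cost + 1

end Test

/-- Programs. `setNat a i x` stores the value of `x` in cell `i` of natural-number array `a`,
`setReal` does the same for real arrays, and `loop b P` repeats `P` while `b` holds. -/
inductive Program where
  | skip
  | setNat (array : ℕ) (index value : NatExpr)
  | setReal (array : ℕ) (index : NatExpr) (value : RealExpr)
  | seq (P Q : Program)
  | cond (b : Test) (P Q : Program)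
  | loop (b : Test) (P : Program)

/-- `Exec P σ t τ`: started in state `σ`, the program `P` halts after exactly `t` steps in
state `τ`. -/
inductive Exec : Program → State → ℕ → State → Prop
  | skip (σ : State) : Exec .skip σ 1 σ
  | setNat (σ : State) (a : ℕ) (i x : NatExpr) :
      Exec (.setNat a i x) σ (i.cost + x.cost + 1)
        { σ with nat := Function.update σ.nat a
                          (Function.update (σ.nat a) (i.eval σ) (x.eval σ)) }
  | setReal (σ : State) (a : ℕ) (i : NatExpr) (x : RealExpr) :
      Exec (.setReal a i x) σ (i.cost + x.cost + 1)
        { σ with real := Function.update σ.real a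
                          (Function.update (σ.real a) (i.eval σ) (x.eval σ)) }
  | seq {P Q : Program} {σ₁ σ₂ σ₃ : State} {t₁ t₂ : ℕ} :
      Exec P σ₁ t₁ σ₂ → Exec Q σ₂ t₂ σ₃ → Exec (.seq P Q) σ₁ (t₁ + t₂) σ₃
  | condTrue {b : Test} {P Q : Program} {σ τ : State} {t : ℕ} :
      b.Holds σ → Exec P σ t τ → Exec (.cond b P Q) σ (b.cost + t) τ
  | condFalse {b : Test} {P Q : Program} {σ τ : State} {t : ℕ} :
      ¬ b.Holds σ → Exec Q σ t τ → Exec (.cond b P Q) σ (b.cost + t) τ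
  | loopTrue {b : Test} {P : Program} {σ₁ σ₂ σ₃ : State} {t₁ t₂ : ℕ} :
      b.Holds σ₁ → Exec P σ₁ t₁ σ₂ → Exec (.loop b P) σ₂ t₂ σ₃ →
        Exec (.loop b P) σ₁ (b.cost + t₁ + t₂) σ₃
  | loopFalse {b : Test} {P : Program} {σ : State} :
      ¬ b.Holds σ → Exec (.loop b P) σ b.cost σ

end RealRAM

/-! ### Geometric graphs and symmetric partial edge drawings -/

/-- A finite simple graph with a straight-line drawing in the Euclidean plane, given by the
positions of its vertices and a list of its edges. Edges are straight segments, and two distinct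
edges do not overlap: their relative interiors share at most one point. -/
structure GeometricGraph where
  numVertices : ℕ
  numEdges : ℕ
  pos : Fin numVertices → EuclideanSpace ℝ (Fin 2)
  pos_injective : Function.Injective pos
  tail : Fin numEdges → Fin numVertices
  head : Fin numEdges → Fin numVertices
  tail_ne_head : ∀ e, tail e ≠ head e
  edges_distinct : ∀ e f, e ≠ f → s(tail e, head e) ≠ s(tail f, head f)
  no_overlap : ∀ e f, e ≠ f →
    (openSegment ℝ (pos (tail e)) (pos (head e)) ∩
      openSegment ℝ (pos (tail f)) (pos (head f))).Subsingleton

namespace GeometricGraph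

variable (G : GeometricGraph)

/-- The edge `e` as a relatively open segment. -/
def edgeSegment (e : Fin G.numEdges) : Set (EuclideanSpace ℝ (Fin 2)) :=
  openSegment ℝ (G.pos (G.tail e)) (G.pos (G.head e))

noncomputable def edgeLength (e : Fin G.numEdges) : ℝ :=
  dist (G.pos (G.tail e)) (G.pos (G.head e))

def Crosses (e f : Fin G.numEdges) : Prop :=
  e ≠ f ∧ (G.edgeSegment e ∩ G.edgeSegment f).Nonempty

/-- The number of crossings: the number of unordered pairs of edges that cross. -/
noncomputable def crossingNumber : ℕ :=
  {p : Fin G.numEdges × Fin G.numEdges | p.1 < p.2 ∧ G.Crosses p.1 p.2}.ncard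

/-- The two stubs of the edge `e` for the stub-to-edge length ratio `r`, as relatively open
segments: the stub at the tail (`false`) and the stub at the head (`true`). -/
noncomputable def stub (r : ℝ) (e : Fin G.numEdges) : Bool → Set (EuclideanSpace ℝ (Fin 2))
  | false => openSegment ℝ (G.pos (G.tail e))
      (AffineMap.lineMap (G.pos (G.tail e)) (G.pos (G.head e)) r)
  | true => openSegment ℝ (G.pos (G.head e))
      (AffineMap.lineMap (G.pos (G.head e)) (G.pos (G.tail e)) r)

/-- Drawing, for every edge `e`, only two stubs of length `δ e` times the length of `e` yields a
symmetric partial edge drawing: no two stubs intersect. The value `δ e = 1 / 2` means that no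
ink of `e` is erased. -/
def IsSPED (δ : Fin G.numEdges → ℝ) : Prop :=
  (∀ e, 0 < δ e ∧ δ e ≤ 1 / 2) ∧
    ∀ p q : Fin G.numEdges × Bool, p ≠ q → Disjoint (G.stub (δ p.1) p.1 p.2) (G.stub (δ q.1) q.1 q.2)

end GeometricGraph

/-- Whether the erased parts are measured by length or relative to the lengths of the edges. -/
inductive ErasureMeasure where
  | ink
  | relative

namespace GeometricGraph

variable (G : GeometricGraph)

/-- The total length, or the total relative length, of the erased middle parts of the edges. -/
noncomputable def erased (δ : Fin G.numEdges → ℝ) : ErasureMeasure → ℝ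
  | .ink => ∑ e, (1 - 2 * δ e) * G.edgeLength e
  | .relative => ∑ e, (1 - 2 * δ e)

/-- `δ` is a SPED that erases at most twice as much as any SPED of the same drawing. -/
def IsTwoApprox (μ : ErasureMeasure) (δ : Fin G.numEdges → ℝ) : Prop :=
  G.IsSPED δ ∧ ∀ δ', G.IsSPED δ' → G.erased δ μ ≤ 2 * G.erased δ' μ

/-- A list, in arbitrary order, of all pairs of crossing edges, each pair once. -/
def IsCrossingList (L : List (Fin G.numEdges × Fin G.numEdges)) : Prop :=
  L.Nodup ∧ ∀ p, p ∈ L ↔ p.1 < p.2 ∧ G.Crosses p.1 p.2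

/-- The initial memory. Natural-number arrays: `0` holds the number of vertices, the number of
edges and the length of `L`; `1` and `2` hold the tails and heads of the edges; `3` and `4` hold
the first and second entries of the pairs in `L`. Real arrays: `0` and `1` hold the coordinates
of the vertices. All other cells hold zero. -/
noncomputable def input (L : List (Fin G.numEdges × Fin G.numEdges)) : RealRAM.State where
  nat a i :=
    match a with
    | 0 => match i with
      | 0 => G.numVertices
      | 1 => G.numEdges
      | 2 => L.length
      | _ => 0
    | 1 => if h : i < G.numEdges then (G.tail ⟨i, h⟩ : ℕ) else 0
    | 2 => if h : i < G.numEdges then (G.head ⟨i, h⟩ : ℕ) else 0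
    | 3 => if h : i < L.length then (L[i].1 : ℕ) else 0
    | 4 => if h : i < L.length then (L[i].2 : ℕ) else 0
    | _ => 0
  real a i :=
    match a with
    | 0 => if h : i < G.numVertices then G.pos ⟨i, h⟩ 0 else 0
    | 1 => if h : i < G.numVertices then G.pos ⟨i, h⟩ 1 else 0
    | _ => 0

/-- The stub ratios that are output: cell `e` of real array `2` holds the fraction of the edge
`e` that is erased in its middle (so `0`, the initial value, means that `e` is drawn entirely). -/
noncomputable def output (σ : RealRAM.State) (e : Fin G.numEdges) : ℝ :=
  (1 - σ.real 2 e) / 2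

end GeometricGraph

/-! ### Hoare-style rules with step bounds -/

namespace RealRAM

/-! Write `y e = 1 - 2 * δ e` for the erased fraction. If `e` and `f` cross, the crossing point
misses the stubs of `e` exactly when `y e` reaches a threshold below 1 determined by its position on
`e`; likewise for `f`. A SPED is thus a choice of fractions in `[0, 1)` that reaches one of the two
thresholds at every crossing (`isSPED_iff`), a weighted vertex cover problem with thresholds.

It is 2-approximated by a local-ratio argument. Start with `y = 0` and treat the crossings in any
order. At an unresolved crossing, compare the costs of lifting `y e` and `y f` to their thresholds,
and spend the smaller cost `d` on both edges. This resolves the crossing. Any solution `z` reaches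
one of the two thresholds, so at that edge the part of `z` above `y` shrinks in cost by `d`. Counted
twice, this pays for the `2 * d` spent. Hence the potential `∑ w (y + 2 max(z - y, 0))`, initially
`2 ∑ w z`, never increases (`PartialSolution.raise`), and it always bounds `∑ w y` from above.

Each crossing takes boundedly many steps, because Cramer's rule gives its position. With a list of
crossings the time is even linear in their number; without one, all pairs of edges are tried. -/

theorem NatExpr.eval_congr {σ τ : State} (h : σ.nat = τ.nat) (x : NatExpr) :
    x.eval σ = x.eval τ := by
  induction x <;> simp_all [eval]

/-- `P`, started in `σ`, halts after at most `K` steps in a state that satisfies `Q`. -/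
def Halts (P : Program) (σ : State) (K : ℕ) (Q : State → Prop) : Prop :=
  ∃ t τ, Exec P σ t τ ∧ t ≤ K ∧ Q τ

namespace Halts

variable {P P' : Program} {σ : State} {K K' : ℕ} {Q Q' : State → Prop} {b : Test}

theorem mono (h : Halts P σ K Q) (hK : K ≤ K') (hQ : ∀ τ, Q τ → Q' τ) : Halts P σ K' Q' := by
  obtain ⟨t, τ, hP, ht, hτ⟩ := h
  exact ⟨t, τ, hP, ht.trans hK, hQ τ hτ⟩

theorem skip (h : Q σ) : Halts .skip σ 1 Q :=
  ⟨1, σ, .skip σ, le_rfl, h⟩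

theorem setNat {a : ℕ} {i x : NatExpr}
    (h : Q { σ with
      nat := Function.update σ.nat a (Function.update (σ.nat a) (i.eval σ) (x.eval σ)) }) :
    Halts (.setNat a i x) σ (i.cost + x.cost + 1) Q :=
  ⟨_, _, .setNat σ a i x, le_rfl, h⟩

theorem setReal {a : ℕ} {i : NatExpr} {x : RealExpr}
    (h : Q { σ with
      real := Function.update σ.real a (Function.update (σ.real a) (i.eval σ) (x.eval σ)) }) :
    Halts (.setReal a i x) σ (i.cost + x.cost + 1) Q :=
  ⟨_, _, .setReal σ a i x, le_rfl, h⟩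

theorem seq (h : Halts P σ K fun τ => Halts P' τ K' Q) : Halts (.seq P P') σ (K + K') Q := by
  obtain ⟨t, τ, hP, ht, t', τ', hP', ht', hτ'⟩ := h
  exact ⟨t + t', τ', .seq hP hP', add_le_add ht ht', hτ'⟩

/-- Charging for both branches makes the bound independent of the state, in agreement with
`straightCost`. -/
theorem cond (hP : b.Holds σ → Halts P σ K Q) (hP' : ¬ b.Holds σ → Halts P' σ K' Q) :
    Halts (.cond b P P') σ (b.cost + (K + K')) Q := by
  by_cases hb : b.Holds σ
  · obtain ⟨t, τ, h, ht, hτ⟩ := hP hb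
    exact ⟨_, τ, .condTrue hb h, by omega, hτ⟩
  · obtain ⟨t, τ, h, ht, hτ⟩ := hP' hb
    exact ⟨_, τ, .condFalse hb h, by omega, hτ⟩

/-- A loop with an invariant indexed by the number of completed iterations. -/
theorem loop {Inv : ℕ → State → Prop} {n : ℕ}
    (hbody : ∀ k < n, ∀ σ, Inv k σ → b.Holds σ ∧ Halts P σ K (Inv (k + 1)))
    (hexit : ∀ σ, Inv n σ → ¬ b.Holds σ) (h : Inv 0 σ) :
    Halts (.loop b P) σ (n * (b.cost + K) + b.cost) (Inv n) := by
  suffices H : ∀ j k σ, j + k = n → Inv k σ →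
      Halts (.loop b P) σ (j * (b.cost + K) + b.cost) (Inv n) from H n 0 σ rfl h
  intro j
  induction j with
  | zero =>
    rintro k σ hk hσ
    obtain rfl : k = n := by omega
    exact ⟨_, σ, .loopFalse (hexit σ hσ), by omega, hσ⟩
  | succ j ih =>
    intro k σ hk hσ
    obtain ⟨hb, t, τ, hP, ht, hτ⟩ := hbody k (by omega) σ hσ
    obtain ⟨t', τ', hP', ht', hτ'⟩ := ih (k + 1) τ (by omega) hτ
    refine ⟨_, τ', .loopTrue hb hP hP', ?_, hτ'⟩
    rw [Nat.succ_mul]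
    omega

end Halts

/-- The cost of a program without loops, if all branches were taken. -/
def Program.straightCost : Program → ℕ
  | .skip => 1
  | .setNat _ i x => i.cost + x.cost + 1
  | .setReal _ i x => i.cost + x.cost + 1
  | .seq P Q => P.straightCost + Q.straightCost
  | .cond b P Q => b.cost + (P.straightCost + Q.straightCost)
  -- A junk value: only loop-free programs are measured this way.
  | .loop _ _ => 0

end RealRAM

/-! ### Crossings in coordinates -/

namespace GeometricGraph

variable (G : GeometricGraph)

/-- A coordinate of the vector from the tail to the head of an edge. -/
noncomputable def direction (c : Fin 2) (e : Fin G.numEdges) : ℝ :=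
  G.pos (G.head e) c - G.pos (G.tail e) c

noncomputable def edgeDet (e f : Fin G.numEdges) : ℝ :=
  G.direction 0 e * G.direction 1 f - G.direction 1 e * G.direction 0 f

/-- The position on `e`, as a fraction of `e`, at which the lines through `e` and `f` meet. -/
noncomputable def crossingParam (e f : Fin G.numEdges) : ℝ :=
  ((G.pos (G.tail f) 0 - G.pos (G.tail e) 0) * G.direction 1 f -
    (G.pos (G.tail f) 1 - G.pos (G.tail e) 1) * G.direction 0 f) / G.edgeDet e f

/-- The fraction of `e` that has to be erased so that the stubs of `e` avoid `f`. -/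
noncomputable def threshold (e f : Fin G.numEdges) : ℝ :=
  |2 * G.crossingParam e f - 1|

noncomputable def point (e : Fin G.numEdges) (s : ℝ) : EuclideanSpace ℝ (Fin 2) :=
  AffineMap.lineMap (G.pos (G.tail e)) (G.pos (G.head e)) s

theorem point_apply (e : Fin G.numEdges) (s : ℝ) (c : Fin 2) :
    G.point e s c = G.pos (G.tail e) c + s * G.direction c e := by
  simp [point, AffineMap.lineMap_apply, direction]
  ring

theorem point_eq_point_iff (e f : Fin G.numEdges) (s t : ℝ) :
    G.point e s = G.point f t ↔
      G.pos (G.tail e) 0 + s * G.direction 0 e = G.pos (G.tail f) 0 + t * G.direction 0 f ∧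
      G.pos (G.tail e) 1 + s * G.direction 1 e = G.pos (G.tail f) 1 + t * G.direction 1 f := by
  simp only [← point_apply]
  constructor
  · intro h
    simp [h]
  · rintro ⟨h₀, h₁⟩
    ext c
    fin_cases c
    · exact h₀
    · exact h₁

theorem pos_tail_ne_pos_head (e : Fin G.numEdges) : G.pos (G.tail e) ≠ G.pos (G.head e) :=
  fun h => G.tail_ne_head e (G.pos_injective h)

theorem point_injective (e : Fin G.numEdges) : Function.Injective (G.point e) :=
  AffineMap.lineMap_injective ℝ (G.pos_tail_ne_pos_head e)

theorem direction_ne_zero (e : Fin G.numEdges) :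
    G.direction 0 e ≠ 0 ∨ G.direction 1 e ≠ 0 := by
  by_contra! h
  apply G.pos_tail_ne_pos_head e
  ext c
  fin_cases c
  · exact (sub_eq_zero.1 h.1).symm
  · exact (sub_eq_zero.1 h.2).symm

theorem mem_edgeSegment {e : Fin G.numEdges} {x : EuclideanSpace ℝ (Fin 2)} :
    x ∈ G.edgeSegment e ↔ ∃ s, 0 < s ∧ s < 1 ∧ G.point e s = x := by
  simp only [edgeSegment, openSegment_eq_image_lineMap, Set.mem_image, Set.mem_Ioo, and_assoc]
  rfl

theorem mem_stub_false {e : Fin G.numEdges} {r : ℝ} (hr : 0 < r)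
    {x : EuclideanSpace ℝ (Fin 2)} :
    x ∈ G.stub r e false ↔ ∃ s, 0 < s ∧ s < r ∧ G.point e s = x := by
  simp only [stub, openSegment_eq_image_lineMap, Set.mem_image, Set.mem_Ioo]
  have key : ∀ u : ℝ, AffineMap.lineMap (G.pos (G.tail e))
      (AffineMap.lineMap (G.pos (G.tail e)) (G.pos (G.head e)) r) u = G.point e (u * r) := by
    intro u
    simp only [point, AffineMap.lineMap_apply, vsub_eq_sub, vadd_eq_add]
    module
  simp only [key]
  constructor
  · rintro ⟨u, ⟨h₀, h₁⟩, rfl⟩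
    exact ⟨u * r, by positivity, by nlinarith, rfl⟩
  · rintro ⟨s, h₀, h₁, rfl⟩
    exact ⟨s / r, ⟨by positivity, (div_lt_one hr).2 h₁⟩, by rw [div_mul_cancel₀ _ hr.ne']⟩

theorem mem_stub_true {e : Fin G.numEdges} {r : ℝ} (hr : 0 < r)
    {x : EuclideanSpace ℝ (Fin 2)} :
    x ∈ G.stub r e true ↔ ∃ s, 1 - r < s ∧ s < 1 ∧ G.point e s = x := by
  simp only [stub, openSegment_eq_image_lineMap, Set.mem_image, Set.mem_Ioo]
  have key : ∀ u : ℝ, AffineMap.lineMap (G.pos (G.head e))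
      (AffineMap.lineMap (G.pos (G.head e)) (G.pos (G.tail e)) r) u =
        G.point e (1 - u * r) := by
    intro u
    simp only [point, AffineMap.lineMap_apply, vsub_eq_sub, vadd_eq_add]
    module
  simp only [key]
  constructor
  · rintro ⟨u, ⟨h₀, h₁⟩, rfl⟩
    exact ⟨1 - u * r, by nlinarith, by nlinarith, rfl⟩
  · rintro ⟨s, h₀, h₁, rfl⟩
    refine ⟨(1 - s) / r, ⟨div_pos (by linarith) hr, (div_lt_one hr).2 (by linarith)⟩, ?_⟩
    rw [div_mul_cancel₀ _ hr.ne', sub_sub_cancel]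

/-- The nearer endpoint is at relative distance `min s (1 - s) = (1 - |2 * s - 1|) / 2`, and the
stubs cover the points for which this is less than `r`. -/
theorem exists_mem_stub_iff {e : Fin G.numEdges} {r s : ℝ} (hr : 0 < r) (h₀ : 0 < s)
    (h₁ : s < 1) : (∃ b, G.point e s ∈ G.stub r e b) ↔ 1 - 2 * r < |2 * s - 1| := by
  simp only [Bool.exists_bool, G.mem_stub_false hr, G.mem_stub_true hr,
    (G.point_injective e).eq_iff, lt_abs]
  constructor
  · rintro (⟨s, h₂, h₃, rfl⟩ | ⟨s, h₂, h₃, rfl⟩)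
    · right; linarith
    · left; linarith
  · rintro (h | h)
    · exact .inr ⟨s, by linarith, h₁, rfl⟩
    · exact .inl ⟨s, h₀, by linarith, rfl⟩

theorem stub_subset_edgeSegment {e : Fin G.numEdges} {r : ℝ} (hr : 0 < r) (hr' : r ≤ 1 / 2)
    (b : Bool) : G.stub r e b ⊆ G.edgeSegment e := by
  intro x hx
  rw [mem_edgeSegment]
  cases b
  · obtain ⟨s, h₀, h₁, rfl⟩ := (G.mem_stub_false hr).1 hx
    exact ⟨s, h₀, by linarith, rfl⟩
  · obtain ⟨s, h₀, h₁, rfl⟩ := (G.mem_stub_true hr).1 hx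
    exact ⟨s, by linarith, h₁, rfl⟩

/-- Parallel edges do not cross, since they would overlap. -/
theorem edgeDet_ne_zero_of_crosses {e f : Fin G.numEdges} (h : G.Crosses e f) :
    G.edgeDet e f ≠ 0 := by
  intro hdet
  obtain ⟨hne, x, hxe, hxf⟩ := h
  obtain ⟨s, hs₀, hs₁, rfl⟩ := G.mem_edgeSegment.1 hxe
  obtain ⟨t, ht₀, ht₁, hst⟩ := G.mem_edgeSegment.1 hxf
  rw [point_eq_point_iff] at hst
  obtain ⟨c, hc₀, hc₁⟩ : ∃ c : ℝ, G.direction 0 f = c * G.direction 0 e ∧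
      G.direction 1 f = c * G.direction 1 e := by
    unfold edgeDet at hdet
    rcases G.direction_ne_zero e with h | h
    · refine ⟨G.direction 0 f / G.direction 0 e, by field_simp, ?_⟩
      field_simp
      linarith
    · refine ⟨G.direction 1 f / G.direction 1 e, ?_, by field_simp⟩
      field_simp
      linarith
  -- The two edges lie on one line, so a common interior point can be moved slightly along it to
  -- give a second one, against `no_overlap`.
  have hev : ∀ᶠ ε : ℝ in nhdsWithin 0 (Set.Ioi 0), s + c * ε < 1 ∧ 0 < s + c * ε ∧ t + ε < 1 := by
    apply Filter.Eventually.filter_mono nhdsWithin_le_nhds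
    refine (Continuous.tendsto (by fun_prop) 0).eventually_lt_const (by simpa) |>.and
      (((Continuous.tendsto (by fun_prop) 0).eventually_const_lt (by simpa)).and
      ((Continuous.tendsto (by fun_prop) 0).eventually_lt_const (by simpa)))
  obtain ⟨ε, ⟨h₁, h₂, h₃⟩, hε⟩ := (hev.and self_mem_nhdsWithin).exists
  have hε : 0 < ε := hε
  have heq : G.point f (t + ε) = G.point e (s + c * ε) := by
    rw [point_eq_point_iff, hc₀, hc₁]
    rw [hc₀, hc₁] at hst
    constructor <;> linarith
  have hmem : G.point f (t + ε) ∈ G.edgeSegment e ∩ G.edgeSegment f :=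
    ⟨G.mem_edgeSegment.2 ⟨_, h₂, h₁, heq.symm⟩, G.mem_edgeSegment.2 ⟨_, by linarith, h₃, rfl⟩⟩
  have hsame : G.point f (t + ε) = G.point f t := by
    rw [(G.point_eq_point_iff f e t s).2 hst]
    exact G.no_overlap e f hne hmem ⟨hxe, hxf⟩
  have := G.point_injective f hsame
  linarith

theorem edgeDet_swap (e f : Fin G.numEdges) : G.edgeDet f e = - G.edgeDet e f := by
  unfold edgeDet
  ring

/-- Cramer's rule for the two linear equations in `s` and `t`. -/
theorem point_eq_point_iff_params {e f : Fin G.numEdges} (h : G.edgeDet e f ≠ 0) {s t : ℝ} :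
    G.point e s = G.point f t ↔ s = G.crossingParam e f ∧ t = G.crossingParam f e := by
  have h' : G.edgeDet f e ≠ 0 := by rwa [edgeDet_swap, neg_ne_zero]
  rw [point_eq_point_iff, crossingParam, crossingParam, eq_div_iff h, eq_div_iff h']
  constructor
  · rintro ⟨h₀, h₁⟩
    unfold edgeDet
    constructor
    · linear_combination G.direction 1 f * h₀ - G.direction 0 f * h₁
    · linear_combination - G.direction 1 e * h₀ + G.direction 0 e * h₁
  · rintro ⟨h₀, h₁⟩
    unfold edgeDet at *
    constructor <;> apply mul_left_cancel₀ h
    · linear_combination G.direction 0 e * h₀ + G.direction 0 f * h₁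
    · linear_combination G.direction 1 e * h₀ + G.direction 1 f * h₁

theorem crosses_iff {e f : Fin G.numEdges} (hne : e ≠ f) :
    G.Crosses e f ↔ G.edgeDet e f ≠ 0 ∧ (0 < G.crossingParam e f ∧ G.crossingParam e f < 1) ∧
      0 < G.crossingParam f e ∧ G.crossingParam f e < 1 := by
  constructor
  · intro h
    have hdet := G.edgeDet_ne_zero_of_crosses h
    obtain ⟨-, x, hxe, hxf⟩ := h
    obtain ⟨s, hs₀, hs₁, rfl⟩ := G.mem_edgeSegment.1 hxe
    obtain ⟨t, ht₀, ht₁, hst⟩ := G.mem_edgeSegment.1 hxf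
    obtain ⟨rfl, rfl⟩ := (G.point_eq_point_iff_params hdet).1 hst.symm
    exact ⟨hdet, ⟨hs₀, hs₁⟩, ht₀, ht₁⟩
  · rintro ⟨hdet, ⟨hs₀, hs₁⟩, ht₀, ht₁⟩
    refine ⟨hne, G.point e (G.crossingParam e f), G.mem_edgeSegment.2 ⟨_, hs₀, hs₁, rfl⟩,
      G.mem_edgeSegment.2 ⟨_, ht₀, ht₁, ?_⟩⟩
    exact ((G.point_eq_point_iff_params hdet).2 ⟨rfl, rfl⟩).symm

theorem Crosses.symm {G : GeometricGraph} {e f : Fin G.numEdges} (h : G.Crosses e f) :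
    G.Crosses f e :=
  ⟨h.1.symm, by rw [Set.inter_comm]; exact h.2⟩

theorem Crosses.threshold_lt_one {G : GeometricGraph} {e f : Fin G.numEdges}
    (h : G.Crosses e f) : G.threshold e f < 1 := by
  obtain ⟨-, ⟨h₀, h₁⟩, -⟩ := (G.crosses_iff h.1).1 h
  rw [threshold, abs_lt]
  constructor <;> linarith

/-- Erasing the fraction `y e` of every edge `e` leaves no conflict at the crossing of `e`, `f`. -/
def Resolves (y : Fin G.numEdges → ℝ) (e f : Fin G.numEdges) : Prop :=
  G.threshold e f ≤ y e ∨ G.threshold f e ≤ y f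

/-- Stubs of distinct edges can only meet at the crossing point of these edges, which lies on stubs
of both exactly when both fractions are below their thresholds. The two stubs of one edge are
disjoint because `δ e ≤ 1 / 2`. -/
theorem isSPED_iff (δ : Fin G.numEdges → ℝ) :
    G.IsSPED δ ↔ (∀ e, 0 < δ e ∧ δ e ≤ 1 / 2) ∧
      ∀ e f, G.Crosses e f → G.Resolves (fun e => 1 - 2 * δ e) e f := by
  refine and_congr_right fun hδ => ⟨fun h e f hc => ?_, fun h p q hpq => ?_⟩
  · by_contra hr
    simp only [Resolves, not_or, not_le] at hr
    obtain ⟨hdet, ⟨hs₀, hs₁⟩, ht₀, ht₁⟩ := (G.crosses_iff hc.1).1 hc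
    obtain ⟨b, hb⟩ := (G.exists_mem_stub_iff (e := e) (hδ e).1 hs₀ hs₁).2 hr.1
    obtain ⟨b', hb'⟩ := (G.exists_mem_stub_iff (e := f) (hδ f).1 ht₀ ht₁).2 hr.2
    rw [← (G.point_eq_point_iff_params hdet).2 ⟨rfl, rfl⟩] at hb'
    exact Set.disjoint_left.1 (h (e, b) (f, b') fun h => hc.1 (congrArg Prod.fst h)) hb hb'
  · obtain ⟨e, b⟩ := p
    obtain ⟨f, b'⟩ := q
    rw [Set.disjoint_left]
    intro x hx hx'
    dsimp only at hx hx'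
    rcases eq_or_ne e f with rfl | hne
    · have hδe := (hδ e).2
      have aux : ∀ x, x ∈ G.stub (δ e) e false → x ∉ G.stub (δ e) e true := by
        intro x h₁ h₂
        obtain ⟨s, -, hs, rfl⟩ := (G.mem_stub_false (hδ e).1).1 h₁
        obtain ⟨t, ht, -, hst⟩ := (G.mem_stub_true (hδ e).1).1 h₂
        have := G.point_injective e hst
        linarith
      cases b <;> cases b'
      · exact hpq rfl
      · exact aux x hx hx'
      · exact aux x hx' hx
      · exact hpq rfl
    · have hxe := G.stub_subset_edgeSegment (hδ e).1 (hδ e).2 b hx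
      have hxf := G.stub_subset_edgeSegment (hδ f).1 (hδ f).2 b' hx'
      have hc : G.Crosses e f := ⟨hne, x, hxe, hxf⟩
      have hdet := G.edgeDet_ne_zero_of_crosses hc
      obtain ⟨s, hs₀, hs₁, rfl⟩ := G.mem_edgeSegment.1 hxe
      obtain ⟨t, ht₀, ht₁, hst⟩ := G.mem_edgeSegment.1 hxf
      rw [← hst] at hx'
      have h₁ := (G.exists_mem_stub_iff (hδ e).1 hs₀ hs₁).1 ⟨b, hx⟩
      have h₂ := (G.exists_mem_stub_iff (hδ f).1 ht₀ ht₁).1 ⟨b', hx'⟩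
      obtain ⟨rfl, rfl⟩ := (G.point_eq_point_iff_params hdet).1 hst.symm
      rcases h e f hc with h | h
      · exact absurd h₁ (not_lt.2 h)
      · exact absurd h₂ (not_lt.2 h)

/-! ### Raising two erased fractions at a time -/

/-- What it costs to erase an edge. -/
noncomputable def weight : ErasureMeasure → Fin G.numEdges → ℝ
  | .ink => G.edgeLength
  | .relative => 1

theorem weight_pos (μ : ErasureMeasure) (e : Fin G.numEdges) : 0 < G.weight μ e := by
  cases μ
  · exact dist_pos.2 (G.pos_tail_ne_pos_head e)
  · exact one_pos

theorem erased_eq (μ : ErasureMeasure) (δ : Fin G.numEdges → ℝ) :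
    G.erased δ μ = ∑ e, G.weight μ e * (1 - 2 * δ e) := by
  cases μ <;> simp [erased, weight, mul_comm]

/-- The erased fractions `y` are a partial solution that resolves the crossings in `S`: what has
been spent so far is paid for twice by the parts of any solution `z` that `y` has caught up with. -/
structure PartialSolution (μ : ErasureMeasure) (S : Set (Fin G.numEdges × Fin G.numEdges))
    (y : Fin G.numEdges → ℝ) : Prop where
  nonneg : ∀ e, 0 ≤ y e
  lt_one : ∀ e, y e < 1
  resolves : ∀ e f, (e, f) ∈ S → G.Crosses e f → G.Resolves y e f
  charge : ∀ z : Fin G.numEdges → ℝ, (∀ e, 0 ≤ z e) →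
    (∀ e f, G.Crosses e f → G.Resolves z e f) →
      ∑ e, G.weight μ e * (y e + 2 * max (z e - y e) 0) ≤ 2 * ∑ e, G.weight μ e * z e

namespace PartialSolution

variable {G} {μ : ErasureMeasure} {S : Set (Fin G.numEdges × Fin G.numEdges)}
  {y : Fin G.numEdges → ℝ} {e f : Fin G.numEdges}

theorem zero (μ : ErasureMeasure) : G.PartialSolution μ ∅ 0 where
  nonneg _ := le_rfl
  lt_one _ := one_pos
  resolves _ _ h := h.elim
  charge z hz _ := by
    rw [Finset.mul_sum]
    refine (Finset.sum_congr rfl fun e _ => ?_).le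
    rw [Pi.zero_apply, sub_zero, max_eq_left (hz e)]
    ring

/-- Dropping the nonnegative `max` terms from the potential leaves the cost of `y`. One order of
each pair suffices, since being resolved is symmetric. -/
theorem isTwoApprox (h : G.PartialSolution μ S y) (hS : ∀ e f, e < f → (e, f) ∈ S) :
    G.IsTwoApprox μ fun e => (1 - y e) / 2 := by
  have hy : ∀ e, 1 - 2 * ((1 - y e) / 2) = y e := fun e => by ring
  constructor
  · rw [isSPED_iff]
    refine ⟨fun e => ?_, fun e f hc => ?_⟩
    · have := h.nonneg e
      have := h.lt_one e
      constructor <;> linarith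
    · simp only [hy]
      rcases lt_or_gt_of_ne hc.1 with hlt | hlt
      · exact h.resolves e f (hS e f hlt) hc
      · exact (h.resolves f e (hS f e hlt) hc.symm).symm
  · intro δ hδ
    rw [isSPED_iff] at hδ
    rw [erased_eq, erased_eq]
    simp only [hy]
    refine le_trans (Finset.sum_le_sum fun e _ => ?_)
      (h.charge (fun e => 1 - 2 * δ e) (fun e => ?_) hδ.2)
    · refine mul_le_mul_of_nonneg_left ?_ (G.weight_pos μ e).le
      have := le_max_right (1 - 2 * δ e - y e) 0
      linarith
    · have := (hδ.1 e).2
      linarith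

theorem insert_of_resolves (h : G.PartialSolution μ S y)
    (hr : G.Crosses e f → G.Resolves y e f) : G.PartialSolution μ (insert (e, f) S) y where
  nonneg := h.nonneg
  lt_one := h.lt_one
  resolves e' f' hS hc := by
    rcases hS with hS | hS
    · obtain ⟨rfl, rfl⟩ := Prod.mk.inj hS
      exact hr hc
    · exact h.resolves e' f' hS hc
  charge := h.charge

/-- Raise `e` up to its threshold and spend the same amount on `f`. -/
theorem raise (h : G.PartialSolution μ S y) (hc : G.Crosses e f) (he : y e < G.threshold e f)
    (hle : G.weight μ e * (G.threshold e f - y e) ≤ G.weight μ f * (G.threshold f e - y f)) :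
    G.PartialSolution μ S (Function.update (Function.update y f
      (y f + G.weight μ e * (G.threshold e f - y e) / G.weight μ f)) e (G.threshold e f)) := by
  have hwe := G.weight_pos μ e
  have hwf := G.weight_pos μ f
  set d := G.weight μ e * (G.threshold e f - y e) with hd
  have hd₀ : 0 < d := mul_pos hwe (by linarith)
  set v := y f + d / G.weight μ f with hv
  set y' := Function.update (Function.update y f v) e (G.threshold e f) with hy'
  have hyf : y f ≤ v := le_add_of_nonneg_right (by positivity)
  -- As `e` is the cheaper edge to finish, `f` does not overshoot its threshold. This keeps `y' f`
  -- below 1, and below `z f` whenever `z` resolves the crossing at `f`.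
  have hvf : v ≤ G.threshold f e := by
    have : d / G.weight μ f ≤ G.threshold f e - y f := (div_le_iff₀' hwf).2 hle
    linarith
  have hdv : G.weight μ f * (v - y f) = d := by
    rw [hv, add_sub_cancel_left, mul_div_cancel₀ _ hwf.ne']
  have hye' : y' e = G.threshold e f := by simp [hy']
  have hyf' : y' f = v := by simp [hy', hc.1.symm]
  have hyg' : ∀ g, g ≠ e → g ≠ f → y' g = y g := fun g h₁ h₂ => by simp [hy', h₁, h₂]
  have hmono : ∀ g, y g ≤ y' g := by
    intro g
    rcases eq_or_ne g e with rfl | hge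
    · rw [hye']; exact he.le
    · rcases eq_or_ne g f with rfl | hgf
      · rw [hyf']; exact hyf
      · rw [hyg' g hge hgf]
  refine ⟨fun g => (h.nonneg g).trans (hmono g), fun g => ?_, fun e' f' hS hc' => ?_,
    fun z hz hzr => ?_⟩
  · rcases eq_or_ne g e with rfl | hge
    · rw [hye']; exact hc.threshold_lt_one
    · rcases eq_or_ne g f with rfl | hgf
      · rw [hyf']; exact hvf.trans_lt hc.symm.threshold_lt_one
      · rw [hyg' g hge hgf]; exact h.lt_one g
  · exact (h.resolves e' f' hS hc').imp (fun h => h.trans (hmono _)) fun h => h.trans (hmono _)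
  · refine le_trans ?_ (h.charge z hz hzr)
    rw [← Finset.add_sum_erase _ _ (Finset.mem_univ e),
      ← Finset.add_sum_erase _ _ (Finset.mem_erase.2 ⟨hc.1.symm, Finset.mem_univ f⟩),
      ← Finset.add_sum_erase _ _ (Finset.mem_univ e),
      ← Finset.add_sum_erase _ _ (Finset.mem_erase.2 ⟨hc.1.symm, Finset.mem_univ f⟩),
      ← add_assoc, ← add_assoc]
    refine add_le_add ?_ (Finset.sum_congr rfl fun g hg => ?_).le
    · rw [hye', hyf']
      -- Any raise increases a term of the potential by at most its price.
      have slow : ∀ {w a b c : ℝ}, 0 < w → a ≤ b →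
          w * (b + 2 * max (c - b) 0) ≤ w * (a + 2 * max (c - a) 0) + w * (b - a) := by
        intro w a b c hw hab
        rw [← mul_add]
        refine mul_le_mul_of_nonneg_left ?_ hw.le
        have : max (c - b) 0 ≤ max (c - a) 0 := max_le_max (by linarith) le_rfl
        linarith
      -- A raise that stays below the solution decreases the term by its price: the price is added
      -- once and saved twice.
      have fast : ∀ {w a b c : ℝ}, a ≤ b → b ≤ c →
          w * (b + 2 * max (c - b) 0) = w * (a + 2 * max (c - a) 0) - w * (b - a) := by
        intro w a b c hab hbc
        rw [max_eq_left (by linarith), max_eq_left (by linarith)]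
        ring
      -- The edge at which `z` resolves the crossing gains `d`, and the other loses at most `d`.
      rcases hzr e f hc with hz | hz
      · have h₁ := fast (w := G.weight μ e) he.le hz
        have h₂ := slow (c := z f) hwf hyf
        linarith
      · have h₁ := fast (w := G.weight μ f) hyf (hvf.trans hz)
        have h₂ := slow (c := z e) hwe he.le
        linarith
    · simp only [Finset.mem_erase] at hg
      rw [hyg' g hg.2.1 hg.1]

theorem insert_raise (h : G.PartialSolution μ S y) (hc : G.Crosses e f)
    (he : y e < G.threshold e f)
    (hle : G.weight μ e * (G.threshold e f - y e) ≤ G.weight μ f * (G.threshold f e - y f)) :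
    G.PartialSolution μ (insert (e, f) S) (Function.update (Function.update y f
      (y f + G.weight μ e * (G.threshold e f - y e) / G.weight μ f)) e (G.threshold e f)) :=
  (h.raise hc he hle).insert_of_resolves fun _ => .inl (by simp)

theorem insert_raise_swap (h : G.PartialSolution μ S y) (hc : G.Crosses e f)
    (hf : y f < G.threshold f e)
    (hle : G.weight μ f * (G.threshold f e - y f) ≤ G.weight μ e * (G.threshold e f - y e)) :
    G.PartialSolution μ (insert (e, f) S) (Function.update (Function.update y e
      (y e + G.weight μ f * (G.threshold f e - y f) / G.weight μ e)) f (G.threshold f e)) :=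
  (h.raise hc.symm hf hle).insert_of_resolves fun _ => .inr (by simp)

end PartialSolution

end GeometricGraph

/-! ### The programs -/

namespace RealRAM

/-- A coordinate of the tail of the edge with the given number. -/
def tailExpr (c : ℕ) (e : NatExpr) : RealExpr := .read c (.read 1 e)

def directionExpr (c : ℕ) (e : NatExpr) : RealExpr :=
  .minus (.read c (.read 2 e)) (tailExpr c e)

def detExpr (e f : NatExpr) : RealExpr :=
  .minus (.times (directionExpr 0 e) (directionExpr 1 f))
    (.times (directionExpr 1 e) (directionExpr 0 f))

def paramExpr (e f : NatExpr) : RealExpr :=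
  .quot
    (.minus (.times (.minus (tailExpr 0 f) (tailExpr 0 e)) (directionExpr 1 f))
      (.times (.minus (tailExpr 1 f) (tailExpr 1 e)) (directionExpr 0 f)))
    (detExpr e f)

/-- The absolute value is computed as the root of a square. -/
def thresholdExpr (e f : NatExpr) : RealExpr :=
  let x := .minus (.times (.const 2) (paramExpr e f)) (.const 1)
  .root (.times x x)

def weightExpr : ErasureMeasure → NatExpr → RealExpr
  | .ink, e => .root (.plus (.times (directionExpr 0 e) (directionExpr 0 e))
      (.times (directionExpr 1 e) (directionExpr 1 e)))
  | .relative, _ => .const 1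

/-- The cost of raising the erased fraction of `e` to its threshold for `f`. -/
def deficitExpr (μ : ErasureMeasure) (e f : NatExpr) : RealExpr :=
  .times (weightExpr μ e) (.minus (thresholdExpr e f) (.read 2 e))

def raiseProgram (μ : ErasureMeasure) (e f : NatExpr) : Program :=
  .seq
    -- The cell of `f` is written first, because the deficit still needs the old fraction of `e`.
    (.setReal 2 f (.plus (.read 2 f) (.quot (deficitExpr μ e f) (weightExpr μ f))))
    (.setReal 2 e (thresholdExpr e f))

def betweenZeroAndOne (x : RealExpr) : Test :=
  .both (.realLT (.const 0) x) (.realLT x (.const 1))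

/-- Test whether `e` and `f` cross, and if so, make sure that their crossing is resolved. -/
def resolveProgram (μ : ErasureMeasure) (e f : NatExpr) : Program :=
  -- A nonzero determinant is recognized by its positive square.
  .cond (.realLT (.const 0) (.times (detExpr e f) (detExpr e f)))
    (.cond (.both (betweenZeroAndOne (paramExpr e f)) (betweenZeroAndOne (paramExpr f e)))
      (.cond (.both (.realLT (.read 2 e) (thresholdExpr e f))
          (.realLT (.read 2 f) (thresholdExpr f e)))
        (.cond (.realLT (deficitExpr μ e f) (deficitExpr μ f e))
          (raiseProgram μ e f) (raiseProgram μ f e))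
        .skip)
      .skip)
    .skip

/-- Cell `i` of an array of work space. -/
def counter (i : ℕ) : NatExpr := .read 5 (.const i)

def setCounter (i : ℕ) (x : NatExpr) : Program := .setNat 5 (.const i) x

def increment (i : ℕ) : Program := setCounter i (.plus (counter i) (.const 1))

def listStep (μ : ErasureMeasure) : Program :=
  .seq (resolveProgram μ (.read 3 (counter 0)) (.read 4 (counter 0))) (increment 0)

def listProgram (μ : ErasureMeasure) : Program :=
  .loop (.natLT (counter 0) (.read 0 (.const 2))) (listStep μ)

def pairStep (μ : ErasureMeasure) : Program :=
  .seq (resolveProgram μ (counter 1) (counter 0)) (increment 1)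

/-- Counter 0 is the larger edge of the pair and counter 1 the smaller, so each unordered pair is
met once. -/
def pairProgram (μ : ErasureMeasure) : Program :=
  .loop (.natLT (counter 0) (.read 0 (.const 1)))
    (.seq (setCounter 1 (.const 0))
      (.seq (.loop (.natLT (counter 1) (counter 0)) (pairStep μ)) (increment 0)))

theorem increment_halts {σ : State} {i : ℕ} {Q : State → Prop}
    (h : Q { σ with
      nat := Function.update σ.nat 5 (Function.update (σ.nat 5) i (σ.nat 5 i + 1)) }) :
    Halts (increment i) σ (increment i).straightCost Q :=
  Halts.setNat h

end RealRAM

/-! ### Correctness and running time of the programs -/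

namespace GeometricGraph

open RealRAM

/-- The input is still in memory. -/
structure Retains (G : GeometricGraph) (L : List (Fin G.numEdges × Fin G.numEdges))
    (σ : State) : Prop where
  nat : ∀ a < 5, σ.nat a = (G.input L).nat a
  real : ∀ a < 2, σ.real a = (G.input L).real a

section Evaluation

variable {G : GeometricGraph} {L : List (Fin G.numEdges × Fin G.numEdges)} {σ : State}
  {x y : NatExpr} {e f : Fin G.numEdges}

theorem Retains.of_eq {τ : State} (h : G.Retains L σ) (hn : τ.nat = σ.nat)
    (hr : ∀ a ≠ 2, τ.real a = σ.real a) : G.Retains L τ :=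
  ⟨fun a ha => by rw [hn, h.nat a ha], fun a ha => by rw [hr a (by omega), h.real a ha]⟩

theorem Retains.setCounter (h : G.Retains L σ) (c : ℕ → ℕ) :
    G.Retains L { σ with nat := Function.update σ.nat 5 c } :=
  ⟨fun a ha => by simp [ha.ne, h.nat a ha], h.real⟩

theorem Retains.eval_tailExpr (h : G.Retains L σ) (he : x.eval σ = e) {c : ℕ} (hc : c < 2) :
    (tailExpr c x).eval σ = G.pos (G.tail e) ⟨c, hc⟩ := by
  interval_cases c <;>
    simp [tailExpr, RealExpr.eval, NatExpr.eval, he, h.nat 1, h.real, input]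

theorem Retains.eval_directionExpr (h : G.Retains L σ) (he : x.eval σ = e) {c : ℕ}
    (hc : c < 2) : (directionExpr c x).eval σ = G.direction ⟨c, hc⟩ e := by
  rw [directionExpr, RealExpr.eval, h.eval_tailExpr he hc, direction]
  interval_cases c <;> simp [RealExpr.eval, NatExpr.eval, he, h.nat 2, h.real, input]

theorem Retains.eval_detExpr (h : G.Retains L σ) (he : x.eval σ = e) (hf : y.eval σ = f) :
    (detExpr x y).eval σ = G.edgeDet e f := by
  simp only [detExpr, RealExpr.eval, h.eval_directionExpr he zero_lt_two,
    h.eval_directionExpr hf zero_lt_two, h.eval_directionExpr he one_lt_two,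
    h.eval_directionExpr hf one_lt_two]
  rfl

theorem Retains.eval_paramExpr (h : G.Retains L σ) (he : x.eval σ = e) (hf : y.eval σ = f) :
    (paramExpr x y).eval σ = G.crossingParam e f := by
  simp only [paramExpr, RealExpr.eval, h.eval_directionExpr hf zero_lt_two,
    h.eval_directionExpr hf one_lt_two, h.eval_tailExpr he zero_lt_two,
    h.eval_tailExpr hf zero_lt_two, h.eval_tailExpr he one_lt_two,
    h.eval_tailExpr hf one_lt_two, h.eval_detExpr he hf]
  rfl

theorem Retains.eval_thresholdExpr (h : G.Retains L σ) (he : x.eval σ = e)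
    (hf : y.eval σ = f) : (thresholdExpr x y).eval σ = G.threshold e f := by
  simp only [thresholdExpr, RealExpr.eval, h.eval_paramExpr he hf, Real.sqrt_mul_self_eq_abs,
    threshold, Rat.cast_ofNat, Rat.cast_one]

theorem Retains.eval_weightExpr (h : G.Retains L σ) (he : x.eval σ = e) (μ : ErasureMeasure) :
    (weightExpr μ x).eval σ = G.weight μ e := by
  cases μ
  · simp only [weightExpr, RealExpr.eval, h.eval_directionExpr he zero_lt_two,
      h.eval_directionExpr he one_lt_two, weight, edgeLength, EuclideanSpace.dist_eq,
      Fin.sum_univ_two, Real.dist_eq, sq_abs]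
    congr 1
    simp only [direction, Fin.zero_eta, Fin.mk_one]
    ring
  · simp [weightExpr, RealExpr.eval, weight]

theorem Retains.eval_deficitExpr (h : G.Retains L σ) (he : x.eval σ = e) (hf : y.eval σ = f)
    (μ : ErasureMeasure) : (deficitExpr μ x y).eval σ =
      G.weight μ e * (G.threshold e f - σ.real 2 e) := by
  rw [deficitExpr, RealExpr.eval, RealExpr.eval, h.eval_weightExpr he,
    h.eval_thresholdExpr he hf, RealExpr.eval, he]

theorem holds_betweenZeroAndOne (x : RealExpr) :
    (betweenZeroAndOne x).Holds σ ↔ 0 < x.eval σ ∧ x.eval σ < 1 := by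
  simp [betweenZeroAndOne, Test.Holds, RealExpr.eval]

/-- The erased fractions stored in memory. -/
def fractions (G : GeometricGraph) (σ : State) (e : Fin G.numEdges) : ℝ := σ.real 2 e

theorem Retains.raiseProgram_halts (h : G.Retains L σ) (he : x.eval σ = e) (hf : y.eval σ = f)
    (μ : ErasureMeasure) {Q : (Fin G.numEdges → ℝ) → Prop}
    (hQ : Q (Function.update (Function.update (G.fractions σ) f (G.fractions σ f +
      G.weight μ e * (G.threshold e f - G.fractions σ e) / G.weight μ f)) e
        (G.threshold e f))) :
    Halts (raiseProgram μ x y) σ (raiseProgram μ x y).straightCost fun τ =>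
      τ.nat = σ.nat ∧ (∀ a ≠ 2, τ.real a = σ.real a) ∧ Q (G.fractions τ) := by
  refine Halts.seq (Halts.setReal (Halts.setReal ?_))
  set v := (RealExpr.plus (.read 2 y) (.quot (deficitExpr μ x y) (weightExpr μ y))).eval σ with hv
  -- The second assignment is evaluated in this intermediate state; the threshold depends only on
  -- the input arrays and is unchanged.
  set σ' : State := { σ with
    real := Function.update σ.real 2 (Function.update (σ.real 2) (y.eval σ) v) } with hσ'
  have h' : G.Retains L σ' := h.of_eq rfl fun a ha => by simp [hσ', ha]
  have hx : x.eval σ' = e := (NatExpr.eval_congr (σ := σ') (τ := σ) rfl x).trans he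
  have hy : y.eval σ' = f := (NatExpr.eval_congr (σ := σ') (τ := σ) rfl y).trans hf
  refine ⟨rfl, fun a ha => by simp [hσ', ha], ?_⟩
  rw [h'.eval_thresholdExpr hx hy, hx]
  convert hQ using 1
  rw [RealExpr.eval, RealExpr.eval, RealExpr.eval, h.eval_deficitExpr he hf,
    h.eval_weightExpr hf, hf] at hv
  funext g
  simp only [fractions, hσ', hf, hv, Function.update_self, Function.update_apply, Fin.val_inj]

/-- A pair that fails a geometric test does not cross and may be added to `S` vacuously. The same
step therefore serves for listed crossings and for arbitrary pairs. -/
theorem Retains.resolveProgram_halts {μ : ErasureMeasure}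
    {S : Set (Fin G.numEdges × Fin G.numEdges)} (h : G.Retains L σ) (he : x.eval σ = e)
    (hf : y.eval σ = f) (hne : e ≠ f) (hS : G.PartialSolution μ S (G.fractions σ)) :
    Halts (resolveProgram μ x y) σ (resolveProgram μ x y).straightCost fun τ =>
      τ.nat = σ.nat ∧ (∀ a ≠ 2, τ.real a = σ.real a) ∧
        G.PartialSolution μ (insert (e, f) S) (G.fractions τ) := by
  have crossing : Test.Holds σ (.realLT (.const 0) (.times (detExpr x y) (detExpr x y))) →
      Test.Holds σ (.both (betweenZeroAndOne (paramExpr x y)) (betweenZeroAndOne (paramExpr y x))) →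
        G.Crosses e f := by
    simp only [Test.Holds, holds_betweenZeroAndOne, h.eval_paramExpr he hf,
      h.eval_paramExpr hf he, RealExpr.eval, h.eval_detExpr he hf, Rat.cast_zero, mul_self_pos]
    exact fun h₁ h₂ => (G.crosses_iff hne).2 ⟨h₁, h₂⟩
  have parallel : ¬ Test.Holds σ (.realLT (.const 0) (.times (detExpr x y) (detExpr x y))) →
      ¬ G.Crosses e f := by
    simp only [Test.Holds, RealExpr.eval, h.eval_detExpr he hf, Rat.cast_zero, mul_self_pos]
    exact mt fun hc => ((G.crosses_iff hne).1 hc).1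
  have outside : ¬ Test.Holds σ (.both (betweenZeroAndOne (paramExpr x y))
      (betweenZeroAndOne (paramExpr y x))) → ¬ G.Crosses e f := by
    simp only [Test.Holds, holds_betweenZeroAndOne, h.eval_paramExpr he hf,
      h.eval_paramExpr hf he]
    exact mt fun hc => ((G.crosses_iff hne).1 hc).2
  have unresolved : Test.Holds σ (.both (.realLT (.read 2 x) (thresholdExpr x y))
      (.realLT (.read 2 y) (thresholdExpr y x))) ↔
        G.fractions σ e < G.threshold e f ∧ G.fractions σ f < G.threshold f e := by
    simp only [Test.Holds, RealExpr.eval, he, hf, h.eval_thresholdExpr he hf,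
      h.eval_thresholdExpr hf he, fractions]
  have cheaper : Test.Holds σ (.realLT (deficitExpr μ x y) (deficitExpr μ y x)) ↔
      G.weight μ e * (G.threshold e f - G.fractions σ e) <
        G.weight μ f * (G.threshold f e - G.fractions σ f) := by
    simp only [Test.Holds, h.eval_deficitExpr he hf, h.eval_deficitExpr hf he, fractions]
  refine Halts.cond (fun h₁ => Halts.cond (fun h₂ => Halts.cond (fun h₃ =>
    Halts.cond (fun h₄ => ?_) fun h₄ => ?_) fun h₃ => Halts.skip ⟨rfl, fun _ _ => rfl, ?_⟩)
    fun h₂ => Halts.skip ⟨rfl, fun _ _ => rfl, ?_⟩)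
    fun h₁ => Halts.skip ⟨rfl, fun _ _ => rfl, ?_⟩
  · exact h.raiseProgram_halts he hf μ
      (hS.insert_raise (crossing h₁ h₂) (unresolved.1 h₃).1 (cheaper.1 h₄).le)
  · exact h.raiseProgram_halts hf he μ
      (hS.insert_raise_swap (crossing h₁ h₂) (unresolved.1 h₃).2 (not_lt.1 (mt cheaper.2 h₄)))
  · refine hS.insert_of_resolves fun _ => ?_
    rw [unresolved, not_and_or, not_lt, not_lt] at h₃
    exact h₃
  · exact hS.insert_of_resolves fun hc => absurd hc (outside h₂)
  · exact hS.insert_of_resolves fun hc => absurd hc (parallel h₁)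

end Evaluation

variable (G : GeometricGraph)

theorem retains_input (L : List (Fin G.numEdges × Fin G.numEdges)) :
    G.Retains L (G.input L) :=
  ⟨fun _ _ => rfl, fun _ _ => rfl⟩

theorem partialSolution_input (L : List (Fin G.numEdges × Fin G.numEdges))
    (μ : ErasureMeasure) : G.PartialSolution μ ∅ (G.fractions (G.input L)) :=
  PartialSolution.zero μ

variable {G}

theorem PartialSolution.mono {μ : ErasureMeasure} {S T : Set (Fin G.numEdges × Fin G.numEdges)}
    {y : Fin G.numEdges → ℝ} (h : G.PartialSolution μ T y)
    (hST : ∀ e f, (e, f) ∈ S → G.Crosses e f → (e, f) ∈ T) : G.PartialSolution μ S y :=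
  ⟨h.nonneg, h.lt_one, fun e f hS hc => h.resolves e f (hST e f hS hc) hc, h.charge⟩

theorem IsCrossingList.length_eq {L : List (Fin G.numEdges × Fin G.numEdges)}
    (hL : G.IsCrossingList L) : L.length = G.crossingNumber := by
  rw [← List.toFinset_card_of_nodup hL.1, ← Set.ncard_coe_finset, crossingNumber]
  congr 1
  ext p
  simp [hL.2]

theorem listProgram_halts (μ : ErasureMeasure) :
    ∃ C, ∀ (G : GeometricGraph) (L : List (Fin G.numEdges × Fin G.numEdges)),
      G.IsCrossingList L → Halts (listProgram μ) (G.input L) (C * (L.length + 1))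
        fun τ => G.IsTwoApprox μ (G.output τ) := by
  refine ⟨(Test.natLT (counter 0) (.read 0 (.const 2))).cost + (listStep μ).straightCost,
    fun G L hL => Halts.mono (Halts.loop (n := L.length) (K := (listStep μ).straightCost) (Inv := fun k σ => G.Retains L σ ∧
    σ.nat 5 0 = k ∧ G.PartialSolution μ {p | p ∈ L.take k} (G.fractions σ)) ?_ ?_ ?_)
    (by rw [mul_add_one, mul_comm L.length]; omega) ?_⟩
  · rintro k hk σ ⟨h, hk', hS⟩
    refine ⟨?_, ?_⟩
    · simpa [Test.Holds, NatExpr.eval, counter, hk', h.nat 0, input] using hk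
    · have he : (NatExpr.read 3 (counter 0)).eval σ = L[k].1 := by
        simp [NatExpr.eval, counter, hk', h.nat 3, input, hk]
      have hf : (NatExpr.read 4 (counter 0)).eval σ = L[k].2 := by
        simp [NatExpr.eval, counter, hk', h.nat 4, input, hk]
      refine Halts.seq ((h.resolveProgram_halts he hf
        ((hL.2 L[k]).1 (List.getElem_mem hk)).1.ne hS).mono le_rfl ?_)
      rintro τ ⟨hn, hr, hS'⟩
      refine increment_halts ⟨(h.of_eq hn hr).setCounter _, ?_, hS'.mono fun e f hef _ => ?_⟩
      · simp [hn, hk']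
      · rw [Set.mem_ofPred_eq, ← List.take_concat_get' L k hk, List.mem_append,
          List.mem_singleton] at hef
        exact hef.symm
  · rintro σ ⟨h, hk, -⟩
    simp [Test.Holds, NatExpr.eval, counter, hk, h.nat 0, input]
  · exact ⟨G.retains_input L, rfl, (G.partialSolution_input L μ).mono (by simp)⟩
  · rintro τ ⟨-, -, hS⟩
    -- Unlisted pairs do not cross, so they impose no condition.
    refine (hS.mono (S := {p | p.1 < p.2}) fun e f hef hc => ?_).isTwoApprox fun e f h => h
    rw [List.take_length]
    exact (hL.2 (e, f)).2 ⟨hef, hc⟩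

/-- The pairs that have been treated when the counters are at `i` and `j`. -/
def pairsBefore (G : GeometricGraph) (i j : ℕ) : Set (Fin G.numEdges × Fin G.numEdges) :=
  {p | p.1 < p.2 ∧ ((p.2 : ℕ) < i ∨ (p.2 : ℕ) = i ∧ (p.1 : ℕ) < j)}

theorem pairProgram_halts (μ : ErasureMeasure) :
    ∃ C, ∀ G : GeometricGraph, Halts (pairProgram μ) (G.input []) (C * (G.numEdges ^ 2 + 1))
      fun τ => G.IsTwoApprox μ (G.output τ) := by
  -- The costs become opaque variables, so that the final estimate is a polynomial inequality.
  obtain ⟨b, hb⟩ : ∃ b, b = (Test.natLT (counter 0) (.read 0 (.const 1))).cost := ⟨_, rfl⟩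
  obtain ⟨b', hb'⟩ : ∃ b', b' = (Test.natLT (counter 1) (counter 0)).cost := ⟨_, rfl⟩
  obtain ⟨c, hc⟩ : ∃ c, c = (pairStep μ).straightCost := ⟨_, rfl⟩
  obtain ⟨r, hr⟩ : ∃ r, r = (setCounter 1 (.const 0)).straightCost := ⟨_, rfl⟩
  obtain ⟨s, hs⟩ : ∃ s, s = (increment 0).straightCost := ⟨_, rfl⟩
  refine ⟨b + (r + (b' + c + b' + s)), fun G => Halts.mono (K := G.numEdges *
    (b + (r + (G.numEdges * (b' + c) + b' + s))) + b) (Q := fun σ => G.Retains [] σ ∧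
    σ.nat 5 0 = G.numEdges ∧ G.PartialSolution μ (G.pairsBefore G.numEdges 0) (G.fractions σ))
    ?_ ?_ ?_⟩
  · rw [hb]
    refine Halts.loop (Inv := fun i σ => G.Retains [] σ ∧ σ.nat 5 0 = i ∧
      G.PartialSolution μ (G.pairsBefore i 0) (G.fractions σ)) ?_ ?_ ?_
    · rintro i hi σ ⟨h, hi', hS⟩
      refine ⟨?_, ?_⟩
      · simpa [Test.Holds, NatExpr.eval, counter, hi', h.nat 0, input] using hi
      rw [hb', hc, hr, hs]
      refine Halts.seq (Halts.setNat (Halts.seq (Halts.mono (Halts.loop (n := i)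
        (Inv := fun j σ => G.Retains [] σ ∧ σ.nat 5 0 = i ∧ σ.nat 5 1 = j ∧
          G.PartialSolution μ (G.pairsBefore i j) (G.fractions σ)) ?_ ?_ ?_)
          (Nat.add_le_add_right (Nat.mul_le_mul_right _ hi.le) _) ?_)))
      · rintro j hj τ ⟨h, hi', hj', hS⟩
        refine ⟨by simpa [Test.Holds, NatExpr.eval, counter, hi', hj'] using hj, ?_⟩
        have he : (counter 1).eval τ = (⟨j, hj.trans hi⟩ : Fin G.numEdges) := hj'
        have hf : (counter 0).eval τ = (⟨i, hi⟩ : Fin G.numEdges) := hi'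
        refine Halts.seq ((h.resolveProgram_halts he hf (by simp [hj.ne]) hS).mono le_rfl ?_)
        rintro τ' ⟨hn, hr, hS'⟩
        refine increment_halts ⟨(h.of_eq hn hr).setCounter _, ?_, ?_, hS'.mono fun e f hef _ => ?_⟩
        · simp [hn, hi']
        · simp [hn, hj']
        · simp only [pairsBefore, Set.mem_ofPred_eq, Set.mem_insert_iff, Prod.mk.injEq,
            Fin.ext_iff, Fin.lt_def] at hef ⊢
          omega
      · rintro τ ⟨-, hi', hj', -⟩
        simp [Test.Holds, NatExpr.eval, counter, hi', hj']
      · exact ⟨h.setCounter _, by simpa [NatExpr.eval] using hi', by simp [NatExpr.eval], hS⟩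
      · rintro τ ⟨h, hi', -, hS⟩
        refine increment_halts ⟨h.setCounter _, by simp [hi'], hS.mono fun e f hef _ => ?_⟩
        -- A row is complete at `j = i`, since the first entry of a pair is smaller than the second.
        simp only [pairsBefore, Set.mem_ofPred_eq, Fin.lt_def] at hef ⊢
        omega
    · rintro σ ⟨h, hi, -⟩
      simp [Test.Holds, NatExpr.eval, counter, hi, h.nat 0, input]
    · refine ⟨G.retains_input [], rfl, (G.partialSolution_input [] μ).mono ?_⟩
      simp [pairsBefore]
  -- The overhead per row is linear in the number of edges and is absorbed by `m ≤ m ^ 2`.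
  · nlinarith [Nat.mul_le_mul_right (b + r + b' + s) (Nat.le_self_pow two_ne_zero G.numEdges)]
  · rintro τ ⟨-, -, hS⟩
    exact hS.isTwoApprox fun e f h => ⟨h, .inl f.2⟩

end GeometricGraph

/-- MinSPED has a 2-approximation, for erased ink as well as for erased relative length. When the
crossing pairs of edges are listed in the input, the time is quadratic in the number of crossings.
When only the geometric graph is given, the time to find the crossings is added, so that it is
quadratic in the number of crossings and edges. -/
theorem mainTheorem7 (μ : ErasureMeasure) :
    (∃ (P : RealRAM.Program) (C : ℕ),
      ∀ (G : GeometricGraph) (L : List (Fin G.numEdges × Fin G.numEdges)), G.IsCrossingList L →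
        ∃ (t : ℕ) (σ : RealRAM.State), RealRAM.Exec P (G.input L) t σ ∧
          t ≤ C * (G.crossingNumber ^ 2 + 1) ∧ G.IsTwoApprox μ (G.output σ)) ∧
    (∃ (P : RealRAM.Program) (C : ℕ),
      ∀ G : GeometricGraph,
        ∃ (t : ℕ) (σ : RealRAM.State), RealRAM.Exec P (G.input []) t σ ∧
          t ≤ C * (G.numEdges ^ 2 + G.crossingNumber ^ 2 + 1) ∧
          G.IsTwoApprox μ (G.output σ)) := by
  constructor
  · obtain ⟨C, hC⟩ := GeometricGraph.listProgram_halts μ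
    refine ⟨RealRAM.listProgram μ, C, fun G L hL => ?_⟩
    obtain ⟨t, σ, hP, ht, hσ⟩ := hC G L hL
    refine ⟨t, σ, hP, ht.trans (Nat.mul_le_mul_left C ?_), hσ⟩
    rw [hL.length_eq]
    exact Nat.add_le_add_right (Nat.le_self_pow two_ne_zero _) 1
  · obtain ⟨C, hC⟩ := GeometricGraph.pairProgram_halts μ
    refine ⟨RealRAM.pairProgram μ, C, fun G => ?_⟩
    obtain ⟨t, σ, hP, ht, hσ⟩ := hC G
    exact ⟨t, σ, hP, ht.trans (Nat.mul_le_mul_left C (by omega)), hσ⟩
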